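/- Theorem 4.4 (Optimal transport state). Let $d\ge 1$ and let $0\le\rho\in L^1(\mathbb{R}^d)$ have integer mass $N=\int_{\mathbb{R}^d}\rho\in\mathbb{N}$. If $N\ge 2$, let, for each $x\in\mathbb{R}^d$, the local radius $R(x)$ be the largest number satisfying $$\int_{B(x,R(x))}\rho(y)\,\mathrm{d}y=1,$$ and let $R_\rho:=\min_{x\in\mathbb{R}^d}R(x)$ (both exist, and $R_\rho>0$). Then there exists an $N$-particle state $\mathbb{P}$, that is, a Borel probability measure on $(\mathbb{R}^d)^N$ that is symmetric under permutations of the $N$ variables $x_1,\dots,x_N\in\mathbb{R}^d$, whose one-body density $\rho_{\mathbb{P}}$ (the sum of the $N$ one-particle marginals of $\mathbb{P}$, equivalently $N$ times the first marginal if $N\ge1$) is the measure $\rho(y)\,\mathrm{d}y$, and such that $$|x_i-x_j|\ \ge\ \max\Big(R_\rho,\ \frac{R(x_i)+R(x_j)}{3}\Big)\qquad\text{for all } 1\le i\ne j\le N,$$ for $\mathbb{P}$-almost every $(x_1,\dots,x_N)$. (For $N\le 1$ the last condition is void.) -/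

import Mathlib

open MeasureTheory Filter Topology Metric

/-- Physical space `ℝ^d` with its Euclidean norm. -/
abbrev Space (d : ℕ) : Type := EuclideanSpace ℝ (Fin d)

/-- Configurations `(x_1, …, x_N) ∈ (ℝ^d)^N`. Only its Borel structure is used. -/
abbrev Config (d N : ℕ) : Type := Fin N → Space d

/-- An `N`-particle state: a symmetric Borel probability measure on `(ℝ^d)^N`. -/
structure IsNParticleState {d N : ℕ} (P : Measure (Config d N)) : Prop where
  isProbabilityMeasure : IsProbabilityMeasure P
  /-- `P (A_{σ 1} × ⋯ × A_{σ N}) = P (A_1 × ⋯ × A_N)` for Borel sets `A_i ⊆ ℝ^d`. -/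
  symmetric : ∀ (σ : Equiv.Perm (Fin N)) (A : Fin N → Set (Space d)),
    (∀ i, MeasurableSet (A i)) →
      P (Set.univ.pi fun i => A (σ i)) = P (Set.univ.pi A)

/-- The one-body density of `P`, as a measure on `ℝ^d`: the sum of its `N` one-particle marginals
(for a symmetric `P`, this is `N` times the first marginal). -/
noncomputable def oneBodyDensity {d N : ℕ} (P : Measure (Config d N)) : Measure (Space d) :=
  ∑ i : Fin N, P.map (fun x => x i)

/-- The absolutely continuous measure `ρ(y) dy`, for a nonnegative function `ρ`. -/
noncomputable def densityMeasure {d : ℕ} (ρ : Space d → ℝ) : Measure (Space d) :=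
  volume.withDensity (fun y => ENNReal.ofReal (ρ y))

/-- The local radius `R(x)`: the largest number with `∫_{B(x, R(x))} ρ = 1`. -/
noncomputable def localRadius {d : ℕ} (ρ : Space d → ℝ) (x : Space d) : ℝ :=
  sSup {r : ℝ | ∫ y in ball x r, ρ y = 1}

/-- The minimum `R_ρ` of the local radius over `ℝ^d`. -/
noncomputable def minLocalRadius {d : ℕ} (ρ : Space d → ℝ) : ℝ :=
  sInf (Set.range (localRadius ρ))

section WellDefined

variable {d : ℕ} {ρ : Space d → ℝ}

theorem ballMass_mono (hρ : Integrable ρ) (h0 : 0 ≤ᵐ[volume] ρ) {s t : Set (Space d)}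
    (hst : s ⊆ t) : ∫ y in s, ρ y ≤ ∫ y in t, ρ y :=
  setIntegral_mono_set hρ.integrableOn (ae_restrict_of_ae h0) hst.eventuallyLE

theorem ballMass_continuous (hd : 0 < d) (hρ : Integrable ρ) (x : Space d) :
    Continuous fun r : ℝ => ∫ y in ball x r, ρ y := by
  have : Nonempty (Fin d) := ⟨⟨0, hd⟩⟩
  have hF : (fun r : ℝ => ∫ y in ball x r, ρ y)
      = fun r : ℝ => ∫ y, (ball x r).indicator ρ y := by
    funext r
    exact (integral_indicator measurableSet_ball).symm
  rw [hF, continuous_iff_continuousAt]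
  intro r
  refine continuousAt_of_dominated (bound := fun y => ‖ρ y‖) ?_ ?_ hρ.norm ?_
  · exact Eventually.of_forall fun s => hρ.aestronglyMeasurable.indicator measurableSet_ball
  · exact Eventually.of_forall fun s => Eventually.of_forall fun y =>
      norm_indicator_le_norm_self _ _
  · have hs : volume (sphere x r) = 0 := Measure.addHaar_sphere volume x r
    have : ∀ᵐ y ∂(volume : Measure (Space d)), y ∉ sphere x r := measure_eq_zero_iff_ae_notMem.mp hs
    filter_upwards [this] with y hy
    rw [mem_sphere] at hy
    rcases lt_or_gt_of_ne hy with h | h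
    · have : (fun s => (ball x s).indicator ρ y) =ᶠ[𝓝 r] fun _ => ρ y := by
        filter_upwards [lt_mem_nhds h] with s hs
        exact Set.indicator_of_mem (mem_ball.mpr hs) _
      exact this.continuousAt
    · have : (fun s => (ball x s).indicator ρ y) =ᶠ[𝓝 r] fun _ => 0 := by
        filter_upwards [gt_mem_nhds h] with s hs
        exact Set.indicator_of_notMem (by rw [mem_ball]; exact not_lt.mpr (le_of_lt hs)) _
      exact this.continuousAt

theorem ballMass_exists_gt (hρ : Integrable ρ) (x : Space d) {c : ℝ} (hc : c < ∫ y, ρ y) :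
    ∃ K : ℝ, 0 < K ∧ c < ∫ y in ball x K, ρ y := by
  have hmono : Monotone fun n : ℕ => ball x (n : ℝ) := fun a b hab =>
    ball_subset_ball (by exact_mod_cast hab)
  have ht := tendsto_setIntegral_of_monotone (μ := volume) (f := ρ)
    (s := fun n : ℕ => ball x (n : ℝ)) (fun n => measurableSet_ball) hmono hρ.integrableOn
  rw [iUnion_ball_nat, setIntegral_univ] at ht
  obtain ⟨n, hn, hn0⟩ := ((ht.eventually_const_lt hc).and (eventually_gt_atTop 0)).exists
  exact ⟨n, by exact_mod_cast hn0, hn⟩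

/-- If `∫ ρ > 1`, the maximum that defines the local radius is attained. -/
theorem isGreatest_localRadius (hd : 0 < d) (hρ : Integrable ρ) (h0 : 0 ≤ᵐ[volume] ρ)
    (h1 : 1 < ∫ y, ρ y) (x : Space d) :
    IsGreatest {r : ℝ | ∫ y in ball x r, ρ y = 1} (localRadius ρ x) := by
  have hcont := ballMass_continuous hd hρ x
  obtain ⟨K, hK0, hK⟩ := ballMass_exists_gt hρ x h1
  have hne : {r : ℝ | ∫ y in ball x r, ρ y = 1}.Nonempty := by
    obtain ⟨r, -, hr⟩ := intermediate_value_Icc hK0.le hcont.continuousOn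
      (show (1 : ℝ) ∈ Set.Icc _ _ from ⟨by simp, hK.le⟩)
    exact ⟨r, hr⟩
  have hbdd : BddAbove {r : ℝ | ∫ y in ball x r, ρ y = 1} := by
    refine ⟨K, fun r hr => ?_⟩
    by_contra! hlt
    have := ballMass_mono hρ h0 (ball_subset_ball (x := x) hlt.le)
    have hr' : ∫ y in ball x r, ρ y = 1 := hr
    linarith
  have hcl : IsClosed {r : ℝ | ∫ y in ball x r, ρ y = 1} := isClosed_eq hcont continuous_const
  exact ⟨hcl.csSup_mem hne hbdd, fun r hr => le_csSup hbdd hr⟩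

theorem localRadius_pos (hd : 0 < d) (hρ : Integrable ρ) (h0 : 0 ≤ᵐ[volume] ρ)
    (h1 : 1 < ∫ y, ρ y) (x : Space d) : 0 < localRadius ρ x := by
  by_contra! h
  have hm : ∫ y in ball x (localRadius ρ x), ρ y = 1 :=
    (isGreatest_localRadius hd hρ h0 h1 x).1
  rw [ball_eq_empty.mpr h] at hm
  simp at hm

/-- If `∫ ρ > 1`, the minimum that defines `R_ρ` is attained. -/
theorem isLeast_minLocalRadius (hd : 0 < d) (hρ : Integrable ρ) (h0 : 0 ≤ᵐ[volume] ρ)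
    (h1 : 1 < ∫ y, ρ y) : IsLeast (Set.range (localRadius ρ)) (minLocalRadius ρ) := by
  have hG := isGreatest_localRadius hd hρ h0 h1
  have hG1 : ∀ x, ∫ y in ball x (localRadius ρ x), ρ y = 1 := fun x => (hG x).1
  have hlip : ∀ x y, localRadius ρ x ≤ localRadius ρ y + dist x y := by
    intro x y
    by_contra! hlt
    have a := ballMass_mono hρ h0 (ball_subset_ball
      (x := y) (show localRadius ρ y ≤ localRadius ρ x - dist x y by linarith))
    have b := ballMass_mono hρ h0 (ball_subset_ball'
      (x := y) (y := x) (ε₁ := localRadius ρ x - dist x y) (ε₂ := localRadius ρ x)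
      (by rw [dist_comm]; linarith))
    rw [hG1] at a b
    have := (hG y).2 (le_antisymm b a)
    linarith
  have hcont : Continuous (localRadius ρ) :=
    (LipschitzWith.of_le_add hlip).continuous
  obtain ⟨K, -, hK⟩ := ballMass_exists_gt hρ (0 : Space d)
    (show (∫ y, ρ y) - 1 < ∫ y, ρ y by linarith)
  have hgrow : ∀ x, ‖x‖ - K ≤ localRadius ρ x := by
    intro x
    by_contra! hlt
    have hdisj : Disjoint (ball x (localRadius ρ x)) (ball (0 : Space d) K) := by
      apply ball_disjoint_ball
      rw [dist_zero_right]
      linarith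
    have hu := setIntegral_union hdisj measurableSet_ball
      (hρ.integrableOn (s := ball x (localRadius ρ x)))
      (hρ.integrableOn (s := ball (0 : Space d) K))
    have hle := ballMass_mono hρ h0
      (Set.subset_univ (ball x (localRadius ρ x) ∪ ball (0 : Space d) K))
    rw [setIntegral_univ, hu, hG1] at hle
    linarith
  have htop : Tendsto (localRadius ρ) (cocompact (Space d)) atTop :=
    tendsto_atTop_mono hgrow
      (tendsto_atTop_add_const_right _ (-K) (tendsto_norm_cocompact_atTop (E := Space d)))
  obtain ⟨x₀, hx₀⟩ := hcont.exists_forall_le htop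
  have hl : IsLeast (Set.range (localRadius ρ)) (localRadius ρ x₀) :=
    ⟨⟨x₀, rfl⟩, by rintro _ ⟨y, rfl⟩; exact hx₀ y⟩
  have : minLocalRadius ρ = localRadius ρ x₀ := hl.csInf_eq
  rw [this]
  exact hl

end WellDefined

/-! Say that `x` and `y` conflict if their distance is below the required separation. Since `R` is
1-Lipschitz, all points in conflict with `x` lie in the ball `B(x, R(x))`, of mass 1. The theorem is
thus the continuum form of a colouring statement: a mass `N` whose conflict neighbourhoods have mass
at most 1 is the density of a random conflict-free `N`-tuple.

On a finite weighted graph this is a duality argument. For any objective, a greedy choice gives an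
independent tuple doing at least as well as the weights (`exists_independent_tuple_sum_le`), so by
Hahn–Banach no functional separates the weights from the convex hull of the occupation numbers of
independent tuples.

Small cells transfer this to the measure, with an error `ε` in the constraint. Fixed marginals give
tightness, and a weak limit removes the error. Averaging over permutations then gives symmetry. -/

/-! ### Finite weighted graphs: greedy selection and duality. -/

/-- Greedy selection: if closed neighbourhoods have weight at most `1` and the total weight is `N`,
some independent `N`-tuple does at least as well as the weights, for any objective `f`. -/
theorem exists_independent_tuple_sum_le {V : Type*} [Fintype V] (adj : V → V → Prop)
    [DecidableRel adj] (f : V → ℝ) (N : ℕ) (w : V → ℝ) (hw : ∀ v, 0 ≤ w v)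
    (hadj : ∀ v, 0 < w v → ∑ u with adj v u, w u ≤ 1) (hsum : ∑ v, w v = N) :
    ∃ t : Fin N → V, (∀ i, 0 < w (t i)) ∧ (∀ i j, i < j → ¬ adj (t i) (t j)) ∧
      ∑ v, w v * f v ≤ ∑ i, f (t i) := by
  induction N generalizing w with
  | zero =>
    refine ⟨Fin.elim0, fun i => i.elim0, fun i => i.elim0, ?_⟩
    have h0 : ∀ v, w v = 0 := fun v =>
      (Finset.sum_eq_zero_iff_of_nonneg fun v _ => hw v).1 (by simpa using hsum) v (Finset.mem_univ v)
    simp [h0]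
  | succ n ih =>
    have hne : (Finset.univ.filter fun v => 0 < w v).Nonempty := by
      by_contra h
      rw [Finset.not_nonempty_iff_eq_empty, Finset.filter_eq_empty_iff] at h
      have : ∑ v, w v ≤ 0 := Finset.sum_nonpos fun v _ => not_lt.1 (h (Finset.mem_univ v))
      rw [hsum] at this
      push_cast at this
      linarith [(Nat.cast_nonneg n : (0 : ℝ) ≤ n)]
    obtain ⟨a, ha, hmax⟩ := Finset.exists_max_image _ f hne
    have ha0 : 0 < w a := (Finset.mem_filter.1 ha).2
    set m : ℝ := ∑ u with adj a u, w u
    set s : ℝ := ∑ u with ¬ adj a u, w u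
    have hms : m + s = n + 1 := by
      have := Finset.sum_filter_add_sum_filter_not Finset.univ (adj a) w
      rw [hsum] at this
      push_cast at this
      exact this
    have hm1 : m ≤ 1 := hadj a ha0
    have hn0 : (0 : ℝ) ≤ n := Nat.cast_nonneg n
    -- The neighbourhood of `a` may weigh less than 1. Shrinking the rest by `c` makes the removed
    -- weight exactly 1; for `n = 0` nothing is kept, which also covers `s = 0`.
    obtain ⟨c, hc0, hc1, hcs⟩ : ∃ c : ℝ, 0 ≤ c ∧ c ≤ 1 ∧ c * s = n := by
      rcases hn0.eq_or_lt with h | h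
      · exact ⟨0, le_rfl, zero_le_one, by simp [← h]⟩
      · have : 0 < s := by linarith
        exact ⟨n / s, by positivity, (div_le_one this).2 (by linarith), div_mul_cancel₀ _ this.ne'⟩
    set w' : V → ℝ := fun v => if adj a v then 0 else c * w v
    have hw'0 : ∀ v, 0 ≤ w' v := fun v => by
      simp only [w']; split_ifs
      · exact le_rfl
      · exact mul_nonneg hc0 (hw v)
    have hw'le : ∀ v, w' v ≤ w v := fun v => by
      simp only [w']; split_ifs
      · exact hw v
      · exact mul_le_of_le_one_left (hw v) hc1
    have hsumw' : ∑ v, w' v = n := by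
      simp only [w', Finset.sum_ite, Finset.sum_const_zero, zero_add, ← Finset.mul_sum]
      exact hcs
    obtain ⟨t, ht0, htadj, htf⟩ := ih w' hw'0
      (fun v hv => (Finset.sum_le_sum fun u _ => hw'le u).trans (hadj v (hv.trans_le (hw'le v))))
      hsumw'
    refine ⟨Fin.cons a t, ?_, ?_, ?_⟩
    · intro i
      refine Fin.cases ha0 (fun i => ?_) i
      exact (ht0 i).trans_le (hw'le _)
    · intro i j hij
      obtain ⟨j, rfl⟩ := Fin.exists_succ_eq.2 (Fin.ne_zero_of_lt hij)
      rcases Fin.eq_zero_or_eq_succ i with rfl | ⟨i, rfl⟩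
      · intro h
        have := ht0 j
        simp only [Fin.cons_zero, Fin.cons_succ] at h
        simp [w', h] at this
      · simpa using htadj i j (by simpa using hij)
    · rw [Fin.sum_univ_succ]
      simp only [Fin.cons_zero, Fin.cons_succ]
      -- The removed weight lives where `w > 0`, and there `f ≤ f a`; its total is 1, so the single
      -- vertex `a` pays for it.
      have h1 : ∑ v, (w v - w' v) * f v ≤ ∑ v, (w v - w' v) * f a := by
        refine Finset.sum_le_sum fun v _ => ?_
        rcases (hw v).eq_or_lt with h | h
        · have : w' v = 0 := le_antisymm (h ▸ hw'le v) (hw'0 v)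
          simp [← h, this]
        · exact mul_le_mul_of_nonneg_left (hmax v (by simpa using h)) (sub_nonneg.2 (hw'le v))
      rw [← Finset.sum_mul, Finset.sum_sub_distrib, hsum, hsumw'] at h1
      simp only [sub_mul, Finset.sum_sub_distrib] at h1
      push_cast at h1
      linarith

/-- Fractional equitable colouring: weights of total mass `N` whose neighbourhoods have weight at
most `1` are the expected occupation numbers of a random independent `N`-tuple. -/
theorem exists_random_independent_tuple {V : Type*} [Fintype V] [DecidableEq V]
    (adj : V → V → Prop)
    [DecidableRel adj] (N : ℕ) (w : V → ℝ) (hw : ∀ v, 0 ≤ w v)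
    (hadj : ∀ v, 0 < w v → ∑ u with adj v u, w u ≤ 1) (hsum : ∑ v, w v = N) :
    ∃ (ι : Type) (_ : Fintype ι) (p : ι → ℝ) (t : ι → Fin N → V),
      (∀ a, 0 ≤ p a) ∧ ∑ a, p a = 1 ∧ (∀ a i, 0 < w (t a i)) ∧
      (∀ a i j, i < j → ¬ adj (t a i) (t a j)) ∧
      ∀ v, ∑ a, ∑ i, (if t a i = v then p a else 0) = w v := by
  let count : (Fin N → V) → V → ℝ := fun t v => ∑ i, if t i = v then 1 else 0
  let S : Set (Fin N → V) := {t | (∀ i, 0 < w (t i)) ∧ ∀ i j, i < j → ¬ adj (t i) (t j)}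
  -- A functional separating `w` from the hull, read as an objective on vertices, would contradict
  -- the greedy tuple.
  have hmem : w ∈ convexHull ℝ (count '' S) := by
    by_contra hnot
    have hclosed : IsClosed (convexHull ℝ (count '' S)) :=
      ((Set.toFinite S).image count).isClosed_convexHull ℝ
    obtain ⟨f, u, hfu, huf⟩ :=
      geometric_hahn_banach_closed_point (convex_convexHull ℝ _) hclosed hnot
    have hf : ∀ x : V → ℝ, f x = ∑ v, x v * f (Pi.single v 1) := fun x => by
      conv_lhs => rw [pi_eq_sum_univ' x]
      simp only [map_sum, map_smul, smul_eq_mul]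
    obtain ⟨t, ht0, htadj, hle⟩ :=
      exists_independent_tuple_sum_le adj (fun v => f (Pi.single v 1)) N w hw hadj hsum
    have h1 := hfu _ (subset_convexHull ℝ _ (Set.mem_image_of_mem count (show t ∈ S from ⟨ht0, htadj⟩)))
    have h2 : f (count t) = ∑ i, f (Pi.single (t i) 1) := by
      rw [hf]
      simp only [count, Finset.sum_mul]
      rw [Finset.sum_comm]
      simp
    rw [h2] at h1
    rw [hf] at huf
    linarith
  obtain ⟨ι, hι, p, z, hp0, hp1, hz, hpz⟩ := mem_convexHull_iff_exists_fintype.1 hmem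
  choose t htS htz using hz
  refine ⟨ι, hι, p, t, hp0, hp1, fun a i => (htS a).1 i, fun a => (htS a).2, fun v => ?_⟩
  rw [← hpz]
  simp only [Finset.sum_apply, Pi.smul_apply, ← htz, count, smul_eq_mul, Finset.mul_sum, mul_ite,
    mul_one, mul_zero]

/-! ### Discretisation into small cells. -/

open Classical in
/-- For a finite measurable labelling whose neighbourhoods have mass at most `1`, there is a
probability measure on `N`-tuples with density `μ` whose labels are almost surely independent. -/
theorem exists_measure_label_independent {X V : Type*} [MeasurableSpace X] [Fintype V]
    [MeasurableSpace V] [MeasurableSingletonClass V] (μ : Measure X) [IsFiniteMeasure μ] (N : ℕ)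
    (hN : μ Set.univ = N) (c : X → V) (hc : Measurable c) (adj : V → V → Prop)
    (hadj : ∀ v, μ (c ⁻¹' {v}) ≠ 0 → μ (c ⁻¹' {u | adj v u}) ≤ 1) :
    ∃ P : Measure (Fin N → X), IsProbabilityMeasure P ∧
      ∑ i, P.map (fun x => x i) = μ ∧
      ∀ᵐ x ∂P, ∀ i j, i < j → ¬ adj (c (x i)) (c (x j)) := by
  have hcell : ∀ v, MeasurableSet (c ⁻¹' {v}) := fun v => hc (measurableSet_singleton v)
  have hsumset : ∀ s : Finset V, ∑ v ∈ s, μ.real (c ⁻¹' {v}) = μ.real (c ⁻¹' s) := fun s =>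
    sum_measureReal_preimage_singleton s fun v _ => hcell v
  obtain ⟨ι, _, p, t, hp0, hp1, htpos, htadj, hcount⟩ :=
    exists_random_independent_tuple adj N (fun v => μ.real (c ⁻¹' {v}))
      (fun v => measureReal_nonneg)
      (fun v hv => by
        rw [hsumset]
        have h := hadj v (fun h0 => by simp [Measure.real, h0] at hv)
        have := ENNReal.toReal_mono ENNReal.one_ne_top h
        simpa [Measure.real] using this)
      (by rw [hsumset]; simp [Measure.real, hN])
  have hne : ∀ a i, μ (c ⁻¹' {t a i}) ≠ 0 := fun a i h0 => by
    have := htpos a i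
    simp [Measure.real, h0] at this
  -- Given the random labels, the particles are independent, each with law `μ` conditioned on its
  -- cell.
  let κ : V → Measure X := fun v => ProbabilityTheory.cond μ (c ⁻¹' {v})
  have hκ : ∀ a i, IsProbabilityMeasure (κ (t a i)) := fun a i =>
    ProbabilityTheory.cond_isProbabilityMeasure (hne a i)
  let Q : ι → Measure (Fin N → X) := fun a => Measure.pi fun i => κ (t a i)
  have hQ : ∀ a, IsProbabilityMeasure (Q a) := fun a => inferInstance
  refine ⟨∑ a, ENNReal.ofReal (p a) • Q a, ⟨?_⟩, ?_, ?_⟩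
  · rw [Measure.finsetSum_apply]
    simp only [Measure.smul_apply, measure_univ, smul_eq_mul, mul_one]
    rw [← ENNReal.ofReal_sum_of_nonneg fun a _ => hp0 a, hp1, ENNReal.ofReal_one]
  · ext s hs
    have hmap : ∀ a i, (Q a) ((fun x => x i) ⁻¹' s) = κ (t a i) s := fun a i =>
      (measurePreserving_eval (fun i => κ (t a i)) i).measure_preimage hs.nullMeasurableSet
    have hrestr : ∀ v, μ (c ⁻¹' {v}) * κ v s = μ (c ⁻¹' {v} ∩ s) := fun v => by
      rw [mul_comm]
      exact ProbabilityTheory.cond_mul_eq_inter (hcell v) s μ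
    have hcount' : ∀ v, ∑ a, ∑ i, (if t a i = v then ENNReal.ofReal (p a) else 0)
        = μ (c ⁻¹' {v}) := fun v => by
      rw [← ofReal_measureReal (μ := μ) (s := c ⁻¹' {v}), ← hcount v,
        ENNReal.ofReal_sum_of_nonneg fun a _ => Finset.sum_nonneg fun i _ => by
          split_ifs; exacts [hp0 a, le_rfl]]
      refine Finset.sum_congr rfl fun a _ => ?_
      rw [ENNReal.ofReal_sum_of_nonneg fun i _ => by split_ifs; exacts [hp0 a, le_rfl]]
      refine Finset.sum_congr rfl fun i _ => ?_
      split_ifs <;> simp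
    calc (∑ i, (∑ a, ENNReal.ofReal (p a) • Q a).map (fun x => x i)) s
        = ∑ i, ∑ a, ENNReal.ofReal (p a) * κ (t a i) s := by
          rw [Measure.finsetSum_apply]
          refine Finset.sum_congr rfl fun i _ => ?_
          rw [Measure.map_apply (measurable_pi_apply i) hs, Measure.finsetSum_apply]
          exact Finset.sum_congr rfl fun a _ => by rw [Measure.smul_apply, hmap, smul_eq_mul]
      _ = ∑ v, ∑ a, ∑ i, (if t a i = v then ENNReal.ofReal (p a) else 0) * κ v s := by
          rw [Finset.sum_comm, Finset.sum_comm (s := Finset.univ (α := V))]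
          refine Finset.sum_congr rfl fun a _ => ?_
          rw [Finset.sum_comm (s := Finset.univ (α := V))]
          refine Finset.sum_congr rfl fun i _ => ?_
          simp [ite_mul]
      _ = ∑ v, μ (c ⁻¹' {v} ∩ s) := by
          refine Finset.sum_congr rfl fun v _ => ?_
          rw [← hrestr, ← hcount']
          simp only [Finset.sum_mul]
      _ = μ s := by
          rw [← measure_biUnion_finset]
          · congr 1
            ext x
            simp
          · intro u _ v _ huv
            refine Disjoint.mono Set.inter_subset_left Set.inter_subset_left ?_
            exact Disjoint.preimage c (Set.disjoint_singleton.2 huv)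
          · exact fun v _ => (hcell v).inter hs
  · rw [ae_iff, Measure.finsetSum_apply, Finset.sum_eq_zero_iff]
    intro a _
    rw [← ae_iff]
    refine Measure.ae_smul_measure ?_ _
    have hlab : ∀ᵐ x ∂Q a, ∀ i, c (x i) = t a i := by
      rw [ae_all_iff]
      intro i
      have : ∀ᵐ y ∂κ (t a i), c y = t a i := by
        filter_upwards [ProbabilityTheory.ae_cond_mem (μ := μ) (hcell (t a i))] with y hy using hy
      exact (measurePreserving_eval (fun i => κ (t a i)) i).quasiMeasurePreserving.ae this
    filter_upwards [hlab] with x hx i j hij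
    rw [hx, hx]
    exact htadj a i j hij

/-- A finite measure lives, up to small mass, on finitely many measurable cells of small diameter. -/
theorem exists_measurable_label_dist_le {X : Type*} [PseudoMetricSpace X] [MeasurableSpace X]
    [OpensMeasurableSpace X] [SecondCountableTopology X] (μ : Measure X) [IsFiniteMeasure μ]
    {r : ℝ} (hr : 0 < r) {ε : ENNReal} (hε : 0 < ε) :
    ∃ (m : ℕ) (c : X → Fin (m + 1)), Measurable c ∧ μ (c ⁻¹' {Fin.last m}) ≤ ε ∧
      ∀ x y, c x = c y → c x ≠ Fin.last m → dist x y ≤ r := by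
  obtain ⟨As, hmeas, hbdd, hdiam, hcover, hdisj⟩ :=
    SeparableSpace.exists_measurable_partition_diam_le X hr
  have hex : ∀ x, ∃ n, x ∈ As n := fun x => Set.mem_iUnion.1 (hcover ▸ Set.mem_univ x)
  choose n hn using hex
  have hpre : ∀ k, n ⁻¹' {k} = As k := fun k => by
    ext x
    refine ⟨fun h => ?_, fun h => ?_⟩
    · rw [← show n x = k from h]
      exact hn x
    · by_contra hne
      exact (hdisj hne).le_bot ⟨hn x, h⟩
  have hnm : Measurable n := measurable_to_countable' fun k => by rw [hpre]; exact hmeas k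
  have htail : Tendsto (fun k => μ (n ⁻¹' Set.Ici k)) atTop (𝓝 0) := by
    have h := tendsto_measure_iInter_atTop (μ := μ) (s := fun k => n ⁻¹' Set.Ici k)
      (fun k => (hnm measurableSet_Ici).nullMeasurableSet)
      (fun a b hab => Set.preimage_mono (Set.Ici_subset_Ici.2 hab)) ⟨0, measure_ne_top _ _⟩
    have hempty : ⋂ k, n ⁻¹' Set.Ici k = ∅ := by
      ext x
      simp only [Set.mem_iInter, Set.mem_preimage, Set.mem_Ici, Set.mem_empty_iff_false, iff_false,
        not_forall, not_le]
      exact ⟨n x + 1, Nat.lt_succ_self _⟩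
    rwa [hempty, measure_empty] at h
  obtain ⟨m, hm⟩ := (htail.eventually_le_const hε).exists
  -- All cells of index at least `m` are merged into one label, of small mass but uncontrolled
  -- diameter.
  refine ⟨m, fun x => ⟨min (n x) m, Nat.lt_succ_of_le (min_le_right _ _)⟩, ?_, ?_, ?_⟩
  · exact (measurable_from_top (f := fun k : ℕ =>
      (⟨min k m, Nat.lt_succ_of_le (min_le_right _ _)⟩ : Fin (m + 1)))).comp hnm
  · refine (measure_mono fun x hx => ?_).trans hm
    simpa [Fin.ext_iff] using hx
  · intro x y hxy hx
    have h1 : min (n x) m = min (n y) m := by simpa [Fin.ext_iff] using hxy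
    have h2 : min (n x) m ≠ m := by simpa [Fin.ext_iff] using hx
    have h3 : n x = n y := by omega
    exact (dist_le_diam_of_mem (hbdd _) (hn x) (h3 ▸ hn y)).trans (hdiam _)

/-- Approximate version: the constraint `0 ≤ h` may be violated by at most `ε`, up to an event of
probability at most `ε`. -/
theorem exists_measure_approx_separated {X : Type*} [PseudoMetricSpace X] [MeasurableSpace X]
    [OpensMeasurableSpace X] [SecondCountableTopology X] (μ : Measure X) [IsFiniteMeasure μ]
    (N : ℕ) (hN : μ Set.univ = N) (h : X → X → ℝ)
    (hlip : ∀ x y x' y', h x' y' ≤ h x y + 2 * (dist x x' + dist y y'))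
    (hμ : ∀ x, μ {y | h x y < 0} ≤ 1) {ε : ℝ} (hε : 0 < ε) :
    ∃ P : Measure (Fin N → X), IsProbabilityMeasure P ∧
      ∑ i, P.map (fun x => x i) = μ ∧
      P {x | ∃ i j, i < j ∧ h (x i) (x j) < -ε} ≤ ENNReal.ofReal ε := by
  -- Two coordinates each move by at most `ε / 4`, and `hlip` has constant 2: total error `ε`.
  obtain ⟨m, c, hc, hlast, hdist⟩ := exists_measurable_label_dist_le μ
    (show 0 < ε / 4 by positivity) (ENNReal.ofReal_pos.2 hε)
  -- Cells are adjacent only if all their pairs conflict. A neighbourhood then lies in `{h x · < 0}`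
  -- for any one `x` in the cell, while non-adjacency yields one good pair near the actual points.
  obtain ⟨P, hP, hPμ, hPadj⟩ := exists_measure_label_independent μ N hN c hc
    (fun u v => ∀ x y, c x = u → c y = v → h x y < 0) (fun v hv => by
      obtain ⟨x, hx⟩ := nonempty_of_measure_ne_zero hv
      refine (measure_mono fun y hy => ?_).trans (hμ x)
      exact (show ∀ x y', c x = v → c y' = c y → h x y' < 0 from hy) x y hx rfl)
  refine ⟨P, hP, hPμ, ?_⟩
  have hsub : {x : Fin N → X | ∃ i j, i < j ∧ h (x i) (x j) < -ε} ≤ᵐ[P]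
      ⋃ i, (fun x : Fin N → X => x i) ⁻¹' (c ⁻¹' {Fin.last m}) := by
    filter_upwards [hPadj] with x hx hbad
    obtain ⟨i, j, hij, hlt⟩ := hbad
    by_contra hnot
    have hnl : ∀ i, c (x i) ≠ Fin.last m := fun i hi => hnot (Set.mem_iUnion.2 ⟨i, hi⟩)
    have := hx i j hij
    push Not at this
    obtain ⟨z, z', hz, hz', hzz⟩ := this
    have h1 := hdist (x i) z hz.symm (hnl i)
    have h2 := hdist (x j) z' hz'.symm (hnl j)
    have h3 := hlip (x i) (x j) z z'
    linarith
  calc P {x | ∃ i j, i < j ∧ h (x i) (x j) < -ε}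
      ≤ P (⋃ i, (fun x : Fin N → X => x i) ⁻¹' (c ⁻¹' {Fin.last m})) := measure_mono_ae hsub
    _ ≤ ∑ i, P ((fun x : Fin N → X => x i) ⁻¹' (c ⁻¹' {Fin.last m})) :=
        measure_iUnion_fintype_le _ _
    -- The union bound is the expected number of particles in the leftover cell, which the density
    -- determines.
    _ = (∑ i, P.map (fun x => x i)) (c ⁻¹' {Fin.last m}) := by
        rw [Measure.finsetSum_apply]
        exact Finset.sum_congr rfl fun i _ =>
          (Measure.map_apply (measurable_pi_apply i) (hc (measurableSet_singleton _))).symm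
    _ ≤ ENNReal.ofReal ε := by rw [hPμ]; exact hlast

/-! ### Tightness and weak limits. -/

section Limit

variable {X : Type*} [MetricSpace X] [MeasurableSpace X] [BorelSpace X]
  [SecondCountableTopology X]

/-- Probability measures on `N`-tuples with a given density are tight. -/
theorem isTightMeasureSet_of_density [CompleteSpace X] (μ : Measure X) [IsFiniteMeasure μ]
    (N : ℕ) : IsTightMeasureSet {P : Measure (Fin N → X) | ∑ i, P.map (fun x => x i) = μ} := by
  rw [isTightMeasureSet_iff_exists_isCompact_measure_compl_le]
  intro ε hε
  obtain ⟨K, hK, hKε⟩ := isTightMeasureSet_iff_exists_isCompact_measure_compl_le.1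
    (isTightMeasureSet_singleton (μ := μ)) ε hε
  refine ⟨Set.univ.pi fun _ => K, isCompact_univ_pi fun _ => hK, fun P hP => ?_⟩
  calc P (Set.univ.pi fun _ => K)ᶜ
      ≤ P (⋃ i, (fun x : Fin N → X => x i) ⁻¹' Kᶜ) := measure_mono fun x hx => by
        simpa [Set.mem_pi] using hx
    _ ≤ ∑ i, P ((fun x : Fin N → X => x i) ⁻¹' Kᶜ) := measure_iUnion_fintype_le _ _
    _ = (∑ i, P.map (fun x => x i)) Kᶜ := by
        rw [Measure.finsetSum_apply]
        exact Finset.sum_congr rfl fun i _ =>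
          (Measure.map_apply (measurable_pi_apply i) hK.measurableSet.compl).symm
    _ ≤ ε := by rw [hP]; exact hKε μ rfl

/-- Having density `μ` is preserved by weak limits. -/
theorem density_eq_of_tendsto (μ : Measure X) [IsFiniteMeasure μ] (N : ℕ)
    {P : ProbabilityMeasure (Fin N → X)} {Ps : ℕ → ProbabilityMeasure (Fin N → X)}
    (hP : Tendsto Ps atTop (𝓝 P))
    (hμ : ∀ n, ∑ i, (Ps n : Measure (Fin N → X)).map (fun x => x i) = μ) :
    ∑ i, (P : Measure (Fin N → X)).map (fun x => x i) = μ := by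
  refine ext_of_forall_integral_eq_of_IsFiniteMeasure fun f => ?_
  have key : ∀ Q : ProbabilityMeasure (Fin N → X),
      ∫ x, f x ∂(∑ i, (Q : Measure (Fin N → X)).map (fun x => x i))
        = ∑ i, ∫ x, f (x i) ∂(Q : Measure (Fin N → X)) := fun Q => by
    rw [integral_finsetSum_measure fun i _ => f.integrable _]
    exact Finset.sum_congr rfl fun i _ =>
      integral_map (measurable_pi_apply i).aemeasurable f.continuous.aestronglyMeasurable
  have hlim : Tendsto (fun n => ∑ i, ∫ x, f (x i) ∂(Ps n : Measure (Fin N → X))) atTop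
      (𝓝 (∑ i, ∫ x, f (x i) ∂(P : Measure (Fin N → X)))) :=
    tendsto_finsetSum _ fun i _ => ProbabilityMeasure.tendsto_iff_forall_integral_tendsto.1 hP
      (f.compContinuous ⟨fun x => x i, continuous_apply i⟩)
  rw [key]
  refine tendsto_nhds_unique hlim ?_
  simp only [← key, hμ]
  exact tendsto_const_nhds

/-- If the sets `{h x · < 0}` have mass at most `1`, there is a probability measure on `N`-tuples
with density `μ` under which `0 ≤ h (x i) (x j)` for `i < j`, almost surely. -/
theorem exists_measure_separated [CompleteSpace X] (μ : Measure X) [IsFiniteMeasure μ]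
    (N : ℕ) (hN : μ Set.univ = N) (h : X → X → ℝ) (hcont : Continuous fun p : X × X => h p.1 p.2)
    (hlip : ∀ x y x' y', h x' y' ≤ h x y + 2 * (dist x x' + dist y y'))
    (hμ : ∀ x, μ {y | h x y < 0} ≤ 1) :
    ∃ P : Measure (Fin N → X), IsProbabilityMeasure P ∧
      ∑ i, P.map (fun x => x i) = μ ∧ ∀ᵐ x ∂P, ∀ i j, i < j → 0 ≤ h (x i) (x j) := by
  have hε : ∀ n : ℕ, (0 : ℝ) < 1 / ((n : ℝ) + 1) := fun n => by positivity
  choose Q hQ hQμ hQh using fun n => exists_measure_approx_separated μ N hN h hlip hμ (hε n)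
  let Ps : ℕ → ProbabilityMeasure (Fin N → X) := fun n => ⟨Q n, hQ n⟩
  have htight : IsTightMeasureSet
      {((P : ProbabilityMeasure (Fin N → X)) : Measure (Fin N → X)) | P ∈ Set.range Ps} := by
    refine (isTightMeasureSet_of_density μ N).subset ?_
    rintro _ ⟨_, ⟨n, rfl⟩, rfl⟩
    exact hQμ n
  obtain ⟨P, -, φ, hφ, hlim⟩ := (isCompact_closure_of_isTightMeasureSet htight).tendsto_subseq
    fun n => subset_closure (Set.mem_range_self n)
  refine ⟨P, inferInstance, density_eq_of_tendsto μ N hlim fun n => hQμ _, ?_⟩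
  -- Violation by more than a fixed `1 / (k + 1)` is an open event, so the portmanteau inequality
  -- bounds its limiting probability; for large `n` it lies in the exceptional event of `Q (φ n)`.
  have hzero : ∀ k : ℕ,
      (P : Measure (Fin N → X)) {x | ∃ i j, i < j ∧ h (x i) (x j) < -(1 / ((k : ℝ) + 1))} = 0 := by
    intro k
    have hopen : IsOpen {x : Fin N → X | ∃ i j, i < j ∧ h (x i) (x j) < -(1 / ((k : ℝ) + 1))} := by
      simp only [Set.ofPred_exists, Set.ofPred_and]
      refine isOpen_iUnion fun i => isOpen_iUnion fun j => isOpen_const.inter ?_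
      have hij : Continuous fun x : Fin N → X => (x i, x j) := by fun_prop
      exact isOpen_lt (hcont.comp hij) continuous_const
    have hε0 : Tendsto (fun n => ENNReal.ofReal (1 / ((φ n : ℝ) + 1))) atTop (𝓝 0) := by
      have := ENNReal.tendsto_ofReal
        ((tendsto_one_div_add_atTop_nhds_zero_nat (𝕜 := ℝ)).comp hφ.tendsto_atTop)
      simpa using this
    refine le_antisymm ?_ zero_le
    refine (ProbabilityMeasure.le_liminf_measure_open_of_tendsto hlim hopen).trans ?_
    rw [← hε0.liminf_eq]
    refine liminf_le_liminf ?_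
    filter_upwards [eventually_ge_atTop k] with n hn
    refine (measure_mono ?_).trans (hQh (φ n))
    rintro x ⟨i, j, hij, hx⟩
    refine ⟨i, j, hij, hx.trans_le (neg_le_neg ?_)⟩
    exact one_div_le_one_div_of_le (by positivity)
      (by gcongr; exact hn.trans (hφ.id_le n))
  have hall : ∀ᵐ x ∂(P : Measure (Fin N → X)), ∀ k : ℕ,
      ¬ ∃ i j, i < j ∧ h (x i) (x j) < -(1 / ((k : ℝ) + 1)) :=
    ae_all_iff.2 fun k => measure_eq_zero_iff_ae_notMem.1 (hzero k)
  filter_upwards [hall] with x hx i j hij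
  by_contra! hneg
  obtain ⟨k, hk⟩ := exists_nat_one_div_lt (neg_pos.2 hneg)
  exact hx k ⟨i, j, hij, by linarith⟩

end Limit

/-! ### Symmetrisation. -/

/-- Averaging over permutations makes a probability measure an `N`-particle state without changing
its one-body density or the almost sure validity of symmetric properties. -/
theorem exists_isNParticleState_of_isProbabilityMeasure {d N : ℕ} (P : Measure (Config d N))
    [IsProbabilityMeasure P] (p : Config d N → Prop) (hp : ∀ᵐ x ∂P, p x)
    (hsymm : ∀ (σ : Equiv.Perm (Fin N)) x, p x → p (x ∘ σ)) :
    ∃ Q : Measure (Config d N), IsNParticleState Q ∧ oneBodyDensity Q = oneBodyDensity P ∧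
      ∀ᵐ x ∂Q, p x := by
  let c : ENNReal := (Fintype.card (Equiv.Perm (Fin N)) : ENNReal)⁻¹
  have hc : (Fintype.card (Equiv.Perm (Fin N)) : ENNReal) * c = 1 :=
    ENNReal.mul_inv_cancel (by simp [Fintype.card_ne_zero]) (ENNReal.natCast_ne_top _)
  let T : Equiv.Perm (Fin N) → Config d N → Config d N := fun σ x => x ∘ σ
  have hT : ∀ σ, Measurable (T σ) := fun σ =>
    measurable_pi_lambda _ fun i => measurable_pi_apply (σ i)
  let Q : Measure (Config d N) := c • ∑ σ, P.map (T σ)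
  have hQ : ∀ s, MeasurableSet s → Q s = c * ∑ σ, P (T σ ⁻¹' s) := fun s hs => by
    simp only [Q, Measure.smul_apply, Measure.finsetSum_apply, smul_eq_mul]
    congr 1
    exact Finset.sum_congr rfl fun σ _ => Measure.map_apply (hT σ) hs
  refine ⟨Q, ⟨⟨?_⟩, ?_⟩, ?_, ?_⟩
  · rw [hQ _ MeasurableSet.univ]
    simp [mul_comm c, hc]
  · intro τ A hA
    rw [hQ _ (MeasurableSet.univ_pi fun i => hA (τ i)), hQ _ (MeasurableSet.univ_pi hA)]
    congr 1
    refine Fintype.sum_equiv (Equiv.mulRight τ⁻¹) _ _ fun σ => ?_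
    congr 1
    ext x
    simp only [T, Set.mem_preimage, Set.mem_univ_pi, Function.comp_apply, Equiv.coe_mulRight,
      Equiv.Perm.mul_apply]
    refine ⟨fun h i => ?_, fun h i => ?_⟩
    · simpa using h (τ⁻¹ i)
    · simpa using h (τ i)
  · ext s hs
    have heval : ∀ i, MeasurableSet ((fun x : Config d N => x i) ⁻¹' s) := fun i =>
      measurable_pi_apply i hs
    simp only [oneBodyDensity, Measure.finsetSum_apply]
    have h1 : ∀ i : Fin N, (Q.map fun x => x i) s
        = c * ∑ σ : Equiv.Perm (Fin N), P ((fun x => x (σ i)) ⁻¹' s) := fun i => by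
      rw [Measure.map_apply (measurable_pi_apply i) hs, hQ _ (heval i)]
      rfl
    have h2 : ∀ i : Fin N, (P.map fun x => x i) s = P ((fun x => x i) ⁻¹' s) := fun i =>
      Measure.map_apply (measurable_pi_apply i) hs
    simp only [h1, h2]
    rw [← Finset.mul_sum, Finset.sum_comm]
    have h3 : ∀ σ : Equiv.Perm (Fin N), ∑ i, P ((fun x : Config d N => x (σ i)) ⁻¹' s)
        = ∑ i, P ((fun x : Config d N => x i) ⁻¹' s) := fun σ =>
      Equiv.sum_comp σ fun i => P ((fun x : Config d N => x i) ⁻¹' s)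
    simp only [h3, Finset.sum_const, nsmul_eq_mul, Finset.card_univ]
    rw [← mul_assoc, mul_comm c, hc, one_mul]
  · refine Measure.ae_smul_measure ?_ c
    rw [ae_iff, Measure.finsetSum_apply, Finset.sum_eq_zero_iff]
    intro σ _
    rw [← ae_iff]
    -- The set where `p` fails need not be measurable, so a measurable null superset is permuted
    -- instead.
    let M : Set (Config d N) := toMeasurable P {x | ¬ p x}
    have hM : P M = 0 := (measure_toMeasurable _).trans (ae_iff.1 hp)
    have hMσ : MeasurableSet (T σ⁻¹ ⁻¹' M) := hT σ⁻¹ (measurableSet_toMeasurable _ _)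
    have hinv : T σ ⁻¹' (T σ⁻¹ ⁻¹' M) = M := by
      ext x
      simp [T, Function.comp_assoc]
    refine measure_mono_null (t := T σ⁻¹ ⁻¹' M) (fun x hx => ?_) ?_
    · refine subset_toMeasurable _ _ fun hpx => hx ?_
      simpa [T, Function.comp_assoc] using hsymm σ _ hpx
    · rw [Measure.map_apply (hT σ) hMσ, hinv, hM]

/-! ### Local radius and conclusion. -/

/-- Otherwise the ball around `y` of radius `R(x) - |x - y|` lies between `B(y, R(y))` and `B(x,
R(x))`, so it has mass 1, against the maximality of `R(y)`. -/
theorem localRadius_le_add_dist {d : ℕ} {ρ : Space d → ℝ} (hd : 0 < d) (hρ : Integrable ρ)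
    (h0 : 0 ≤ᵐ[volume] ρ) (h1 : 1 < ∫ y, ρ y) (x y : Space d) :
    localRadius ρ x ≤ localRadius ρ y + dist x y := by
  have hG := isGreatest_localRadius hd hρ h0 h1
  have hG1 : ∀ x, ∫ y in ball x (localRadius ρ x), ρ y = 1 := fun x => (hG x).1
  by_contra! hlt
  have a := ballMass_mono hρ h0 (ball_subset_ball
    (x := y) (show localRadius ρ y ≤ localRadius ρ x - dist x y by linarith))
  have b := ballMass_mono hρ h0 (ball_subset_ball'
    (x := y) (y := x) (ε₁ := localRadius ρ x - dist x y) (ε₂ := localRadius ρ x)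
    (by rw [dist_comm]; linarith))
  rw [hG1] at a b
  have := (hG y).2 (le_antisymm b a)
  linarith

theorem densityMeasure_apply {d : ℕ} {ρ : Space d → ℝ} (hρ : Integrable ρ)
    (h0 : 0 ≤ᵐ[volume] ρ) {s : Set (Space d)} (hs : MeasurableSet s) :
    densityMeasure ρ s = ENNReal.ofReal (∫ y in s, ρ y) := by
  rw [densityMeasure, withDensity_apply _ hs,
    ofReal_integral_eq_lintegral_ofReal hρ.integrableOn (ae_restrict_of_ae h0)]

/-- If `ρ ≥ 0` is integrable on `ℝ^d` with integer mass `N`, then some `N`-particle state with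
one-body density `ρ` satisfies `|x_i - x_j| ≥ max (R_ρ, (R(x_i) + R(x_j)) / 3)` for all `i ≠ j`,
almost surely. For `N ≤ 1`, where the local radius is not defined, the last condition is void. -/
theorem theorem4p4 (d N : ℕ) (hd : 0 < d) (ρ : Space d → ℝ)
    (hρ : Integrable ρ volume) (hρ_nonneg : 0 ≤ᵐ[volume] ρ)
    (hN : ∫ y, ρ y = (N : ℝ)) :
    ∃ P : Measure (Config d N), IsNParticleState P ∧
      oneBodyDensity P = densityMeasure ρ ∧
      ∀ᵐ x ∂P, ∀ i j : Fin N, i ≠ j →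
        max (minLocalRadius ρ) ((localRadius ρ (x i) + localRadius ρ (x j)) / 3)
          ≤ ‖x i - x j‖ := by
  have hmass : densityMeasure ρ Set.univ = N := by
    rw [densityMeasure_apply hρ hρ_nonneg MeasurableSet.univ, setIntegral_univ, hN,
      ENNReal.ofReal_natCast]
  have hfin : IsFiniteMeasure (densityMeasure ρ) := ⟨by rw [hmass]; exact ENNReal.natCast_lt_top N⟩
  -- For `N ≤ 1` the radii may be default values of `sSup`; the constant 0 makes the constraint
  -- void.
  let h : Space d → Space d → ℝ := fun x y => if N ≤ 1 then 0 else
    dist x y - max (minLocalRadius ρ) ((localRadius ρ x + localRadius ρ y) / 3)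
  have hcond : Continuous (fun p : Space d × Space d => h p.1 p.2) ∧
      (∀ x y x' y', h x' y' ≤ h x y + 2 * (dist x x' + dist y y')) ∧
      ∀ x, densityMeasure ρ {y | h x y < 0} ≤ 1 := by
    by_cases hN1 : N ≤ 1
    · simp only [h, hN1, if_true, lt_irrefl, Set.ofPred_false, measure_empty, zero_le, implies_true,
        and_true, zero_add]
      exact ⟨continuous_const, fun _ _ _ _ => by positivity⟩
    have h1 : 1 < ∫ y, ρ y := by rw [hN]; exact_mod_cast not_le.1 hN1
    have hlip := localRadius_le_add_dist hd hρ hρ_nonneg h1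
    have hRcont : Continuous (localRadius ρ) := (LipschitzWith.of_le_add hlip).continuous
    simp only [h, hN1, if_false]
    refine ⟨by fun_prop, fun x y x' y' => ?_, fun x => ?_⟩
    · have hx := hlip x x'
      have hy := hlip y y'
      have htri : dist x' y' ≤ dist x y + (dist x x' + dist y y') := by
        have := dist_triangle4 x' x y y'
        rw [dist_comm x' x] at this
        linarith
      have hdx : 0 ≤ dist x x' := dist_nonneg
      have hdy : 0 ≤ dist y y' := dist_nonneg
      have hl := le_max_left (minLocalRadius ρ) ((localRadius ρ x' + localRadius ρ y') / 3)
      have hr := le_max_right (minLocalRadius ρ) ((localRadius ρ x' + localRadius ρ y') / 3)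
      have hmax : max (minLocalRadius ρ) ((localRadius ρ x + localRadius ρ y) / 3)
          ≤ max (minLocalRadius ρ) ((localRadius ρ x' + localRadius ρ y') / 3)
            + (dist x x' + dist y y') := max_le (by linarith) (by linarith)
      linarith
    -- This is where the 3 comes from: `|x - y| < (R(x) + R(y)) / 3` and `R(y) ≤ R(x) + |x - y|`
    -- give `|x - y| < R(x)`.
    · have hball : {y | dist x y - max (minLocalRadius ρ)
          ((localRadius ρ x + localRadius ρ y) / 3) < 0} ⊆ ball x (localRadius ρ x) := by
        intro y hy
        rw [Set.mem_ofPred_eq] at hy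
        rw [mem_ball, dist_comm]
        rcases lt_max_iff.1 (sub_neg.1 hy) with hlt | hlt
        · exact hlt.trans_le ((isLeast_minLocalRadius hd hρ hρ_nonneg h1).2 ⟨x, rfl⟩)
        · have := hlip y x
          rw [dist_comm] at this
          linarith
      refine (measure_mono hball).trans ?_
      rw [densityMeasure_apply hρ hρ_nonneg measurableSet_ball,
        (isGreatest_localRadius hd hρ hρ_nonneg h1 x).1, ENNReal.ofReal_one]
  have hsymm : ∀ x y, h x y = h y x := fun x y => by
    simp only [h, dist_comm x y, add_comm (localRadius ρ x)]
  obtain ⟨P₀, hP₀, hP₀ρ, hP₀h⟩ :=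
    exists_measure_separated (densityMeasure ρ) N hmass h hcond.1 hcond.2.1 hcond.2.2
  obtain ⟨P, hP, hPρ, hPh⟩ := exists_isNParticleState_of_isProbabilityMeasure P₀
    (fun x => ∀ i j : Fin N, i ≠ j → 0 ≤ h (x i) (x j))
    (by
      filter_upwards [hP₀h] with x hx i j hij
      rcases lt_or_gt_of_ne hij with hlt | hlt
      · exact hx i j hlt
      · rw [hsymm]; exact hx j i hlt)
    (fun σ x hx i j hij => hx (σ i) (σ j) (σ.injective.ne hij))
  refine ⟨P, hP, hPρ.trans hP₀ρ, ?_⟩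
  filter_upwards [hPh] with x hx i j hij
  have hN1 : ¬ N ≤ 1 := fun hle => hij <| by
    have := Fin.subsingleton_iff_le_one.2 hle
    exact Subsingleton.elim i j
  have := hx i j hij
  simp only [h, hN1, if_false] at this
  rw [← dist_eq_norm]
  linarith
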